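/- **Setting.** Fix four distinct points $z_1\in\mathbb{C}\setminus\{0,1\}$, $z_2=0$, $z_3=1$, $z_4=\infty$ of $\mathbb{CP}^1$, put $D=\sum_i z_i$, and let $E=\mathcal{O}(m_1)\oplus\mathcal{O}(m_2)$, $m_1\ge m_2$, $d=m_1+m_2$. A quasi-parabolic Higgs bundle on $E$ is a tuple $x=(F_1,\dots,F_4,\Phi)$ with lines $F_i\subset E|_{z_i}$ and $\Phi\in H^0(\mathrm{End}(E)\otimes K(D))$ such that each $\mathrm{Res}_{z_i}\Phi$ is nilpotent and kills $F_i$; the group $\mathbb{P}(\mathrm{Aut}(E))$ acts on the set $\mathrm{QPH}(E)$ of these. For a line sub-bundle $L\subset E$ let $I_L=\{i: L|_{z_i}=F_i\}$. For $\beta\in(0,1)^4$ and $I\subset\{1,2,3,4\}$ put $\beta_I=\sum_{i\in I}\beta_i-\sum_{i\notin I}\beta_i$. The point $x$ is *stable* for $\beta$ if $\beta_{I_L}<d-2\deg L$ for every $\Phi$-invariant line sub-bundle $L\subset E$. **Chambers.** Let $\mathcal{H}_{I,k}=\{\beta\in[0,1]^4:\beta_I=k\}$. The open chambers are the connected components of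 the complement in $(0,1)^4$ of all $\mathcal{H}_{I,k}$ with $k\in\{|I|-1,|I|-2,|I|-3\}$ and $k\equiv d \pmod 2$. Let $\mathcal{B}=\{\beta\in[0,1]^4:\beta_I\le|I|-1\text{ for all } I \text{ with }|I|\equiv d+1 \pmod 2\}$. A partition set $\mathcal{I}$ is a set of subsets $I$ with $|I|\equiv d\pmod 2$ that contains exactly one of $I,I^c$ for every such $I$. The interior chamber $\mathcal{C}_{\mathcal{I}}$ is the open chamber contained in $\mathcal{B}$ on which $\beta_I<|I|-2$ for all $I\in\mathcal{I}$. For $|I'|\equiv d+1\pmod 2$, the exterior chamber $\mathcal{C}_{I'}$ is the open chamber not contained in $\mathcal{B}$ whose closure contains $\mathcal{H}_{I',|I'|-3}$. Let $v_I\in\{0,1\}^4$ be the vertex with coordinates $0$ on $I$ and $1$ on $I^c$, and $\mathcal{I}(I')=\{I: v_I\in\mathcal{H}_{I',|I'|-3}\}$. A point of $\mathrm{QPH}(E)$ is *conditionally stable* if it is stable for some $\beta$ in some open chamber. **Loci.** For $j\le m_2$ let $\mathrm{B}_{I,j}$ be the set of $(F_i)$ for which some line sub-bundle $L\subset E$ of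 degree $j$ has $I\subset I_L$; define $\mathrm{B}_{I,m_1}$ by the same formula if $m_1=m_2$, and by $I_{E_1}=I$ if $m_1>m_2$, where $E_1=\mathcal{O}(m_1)$ is the destabilizing sub-bundle; $\mathrm{B}_{I,j}=\emptyset$ for all other $j$. Let $\mathrm{U}$ be the complement of $\bigcup_{I}\left(\mathrm{B}_{I,m_1}\cap\mathrm{B}_{I^c,m_2}\right)$. For $|I|\equiv d\pmod 2$ and $j=(d+2-|I|)/2$, $\mathcal{N}_I$ is the set of orbits of the points $(F_1,\dots,F_4,0)$ with $(F_i)\in\mathrm{B}_{I,j}\cap\mathrm{U}$. A nonzero $\Phi$ with $\det\Phi=0$ has a unique kernel line sub-bundle $L(\Phi)$. The *$I$-basic building blocks* of $E$ are the sets of orbits of conditionally stable points with $\Phi\ne0$, $\det\Phi=0$, $I_{L(\Phi)}=I$ and either $m_1>m_2$ and $L(\Phi)=E_1$ (this block is $\mathcal{K}_I$), or $\deg L(\Phi)=j$ for a fixed $j\le m_2$ (these are $\mathcal{L}_I$). **Proposition.** (i) For every interior chamber $\mathcal{C}_{\mathcal{I}}$ and every $\beta\in\mathcal{C}_{\mathcal{I}}$,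 a point of $\mathrm{QPH}(E)$ whose orbit lies in $\mathcal{N}_I$ is stable for $\beta$ if and only if $I\in\mathcal{I}$. (ii) For every interior chamber $\mathcal{C}_{\mathcal{I}}$ and every $\beta\in\mathcal{C}_{\mathcal{I}}$, a point whose orbit lies in an $I$-basic building block is stable for $\beta$ if and only if $I\in\mathcal{I}$. For every exterior chamber $\mathcal{C}_{I'}$ and every $\beta\in\mathcal{C}_{I'}$, such a point is stable for $\beta$ if and only if $I\in\mathcal{I}(I')$ or $I=I'$. -/

import Mathlib

open MvPolynomial
open scoped LinearAlgebra.Projectivization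

/-! ### Rank two bundles on the projective line, written through homogeneous coordinates

`E = 𝒪(m 0) ⊕ 𝒪(m 1)` with `m 1 ≤ m 0`.  Sections of `𝒪(n)` are the binary forms of degree `n`.
The fibre of `𝒪(n)` over a point of the projective line is identified with `ℂ` by evaluation at a
chosen nonzero vector that represents the point; the fibre of `E` becomes `Fin 2 → ℂ`.
Subsets of `{1,2,3,4}` are finsets in `Fin 4`. -/

noncomputable section

namespace ParHiggs

/-- Polynomials in the two homogeneous coordinates of the projective line. -/
abbrev Poly : Type := MvPolynomial (Fin 2) ℂ

/-- `H⁰(ℂℙ¹, 𝒪(n))`: binary forms of degree `n`, zero for `n < 0`. -/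
def H0 (n : ℤ) : Submodule ℂ Poly :=
  if 0 ≤ n then homogeneousSubmodule (Fin 2) ℂ n.toNat else ⊥

/-- Representatives of the four marked points `z₁ = [z₁ : 1]`, `z₂ = 0 = [0 : 1]`,
`z₃ = 1 = [1 : 1]`, `z₄ = ∞ = [1 : 0]`. -/
def pt (z₁ : ℂ) : Fin 4 → (Fin 2 → ℂ) := ![![z₁, 1], ![0, 1], ![1, 1], ![1, 0]]

/-- The value of a matrix of binary forms at a vector. -/
def evalMat (v : Fin 2 → ℂ) (M : Matrix (Fin 2) (Fin 2) Poly) : Matrix (Fin 2) (Fin 2) ℂ :=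
  M.map (MvPolynomial.eval v)

/-- The degree of `E`. -/
def deg (m : Fin 2 → ℤ) : ℤ := m 0 + m 1

/-- A line sub-bundle of degree `j` of `E`, given by a generator, i.e. a nowhere vanishing map
`𝒪(j) → E`.  Generators that differ by a nonzero scalar give the same sub-bundle; every notion
below is unchanged under such a rescaling. -/
structure LineSub (m : Fin 2 → ℤ) (j : ℤ) where
  s : Fin 2 → Poly
  mem : ∀ a, s a ∈ H0 (m a - j)
  nowhere_zero : ∀ v : Fin 2 → ℂ, v ≠ 0 → ∃ a, MvPolynomial.eval v (s a) ≠ 0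

/-- A generator of the fibre of a line sub-bundle over (the point represented by) `v`. -/
def LineSub.fibre {m : Fin 2 → ℤ} {j : ℤ} (L : LineSub m j) (v : Fin 2 → ℂ) : Fin 2 → ℂ :=
  fun a => MvPolynomial.eval v (L.s a)

/-- Quasi-parabolic structures on `E`: a line in the fibre at each marked point. -/
abbrev QP : Type := Fin 4 → ℙ ℂ (Fin 2 → ℂ)

open Classical in
/-- `I_{L,E.}`: the set of those `i` for which the fibre of `L` at `z_i` is the flag `F_i`. -/
def incidence (z₁ : ℂ) {m : Fin 2 → ℤ} {j : ℤ} (L : LineSub m j) (F : QP) : Finset (Fin 4) :=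
  Finset.univ.filter fun i => L.fibre (pt z₁ i) ∈ (F i).submodule

/-- `QPH(E)`: quasi-parabolic Higgs bundles supported on `E`.  Under `K(D) ≅ 𝒪(2)` a section of
`End(E) ⊗ K(D)` is a matrix of binary forms, and its residue at `z_i` is a nonzero multiple of its
value at `pt z₁ i`. -/
structure QPH (m : Fin 2 → ℤ) (z₁ : ℂ) where
  F : QP
  Φ : Matrix (Fin 2) (Fin 2) Poly
  mem : ∀ a b, Φ a b ∈ H0 (m a - m b + 2)
  nilpotent : ∀ i, IsNilpotent (evalMat (pt z₁ i) Φ)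
  ker : ∀ i, ∀ v ∈ (F i).submodule, (evalMat (pt z₁ i) Φ).mulVec v = 0

/-- The line sub-bundle `L` is `Φ`-invariant: `Φ L ⊂ L ⊗ K(D)`. -/
def IsInvariant {m : Fin 2 → ℤ} {j : ℤ} (Φ : Matrix (Fin 2) (Fin 2) Poly) (L : LineSub m j) :
    Prop :=
  ∃ f ∈ H0 2, Φ.mulVec L.s = f • L.s

/-! ### Stability -/

/-- `β_I = ∑_{i ∈ I} β_i - ∑_{i ∉ I} β_i`. -/
def betaSum (I : Finset (Fin 4)) (β : Fin 4 → ℝ) : ℝ := ∑ i ∈ I, β i - ∑ i ∈ Iᶜ, β i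

/-- Stability with respect to the weights `β`. -/
def IsStable {m : Fin 2 → ℤ} {z₁ : ℂ} (β : Fin 4 → ℝ) (x : QPH m z₁) : Prop :=
  ∀ (j : ℤ) (L : LineSub m j), IsInvariant x.Φ L →
    betaSum (incidence z₁ L x.F) β < ((deg m - 2 * j : ℤ) : ℝ)

/-! ### Automorphisms and orbits -/

theorem H0_mul {p q : ℤ} {f g : Poly} (hf : f ∈ H0 p) (hg : g ∈ H0 q) : f * g ∈ H0 (p + q) := by
  unfold H0 at *
  split_ifs at hf with hp
  · split_ifs at hg with hq
    · rw [if_pos (by omega), Int.toNat_add hp hq]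
      exact MvPolynomial.IsHomogeneous.mul hf hg
    · rw [Submodule.mem_bot] at hg
      simp [hg]
  · rw [Submodule.mem_bot] at hf
    simp [hf]

theorem H0_one : (1 : Poly) ∈ H0 0 := by
  unfold H0
  rw [if_pos le_rfl]
  exact MvPolynomial.isHomogeneous_one (Fin 2) ℂ

/-- `Aut(E)`: the invertible elements of the algebra `H⁰(End E)`. -/
def AutE (m : Fin 2 → ℤ) : Subgroup (GL (Fin 2) Poly) where
  carrier := {g | (∀ a b, g.val a b ∈ H0 (m a - m b)) ∧ ∀ a b, g⁻¹.val a b ∈ H0 (m a - m b)}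
  one_mem' := by
    have h : ∀ a b, (1 : Matrix (Fin 2) (Fin 2) Poly) a b ∈ H0 (m a - m b) := by
      intro a b
      by_cases hab : a = b
      · subst hab
        simpa using H0_one
      · rw [Matrix.one_apply_ne hab]
        exact Submodule.zero_mem _
    exact ⟨by simpa using h, by simpa using h⟩
  mul_mem' := by
    have key : ∀ M N : Matrix (Fin 2) (Fin 2) Poly, (∀ a b, M a b ∈ H0 (m a - m b)) →
        (∀ a b, N a b ∈ H0 (m a - m b)) → ∀ a b, (M * N) a b ∈ H0 (m a - m b) := by
      intro M N hM hN a b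
      rw [Matrix.mul_apply]
      refine Submodule.sum_mem _ fun c _ => ?_
      have h := H0_mul (hM a c) (hN c b)
      rwa [sub_add_sub_cancel] at h
    rintro g h ⟨hg, hg'⟩ ⟨hh, hh'⟩
    refine ⟨by simpa using key _ _ hg hh, ?_⟩
    rw [mul_inv_rev]
    exact key _ _ hh' hg'
  inv_mem' := by
    rintro g ⟨hg, hg'⟩
    exact ⟨hg', by simpa using hg⟩

/-- `g ∈ Aut(E)` carries `x` to `y`, where `g · (F_i, Φ) = (g(z_i) F_i, g Φ g⁻¹)`. -/
def Carries {m : Fin 2 → ℤ} {z₁ : ℂ} (g : GL (Fin 2) Poly) (x y : QPH m z₁) : Prop :=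
  (∀ i, (y.F i).submodule =
    (x.F i).submodule.map (Matrix.mulVecLin (evalMat (pt z₁ i) g.val))) ∧
  y.Φ = g.val * x.Φ * g⁻¹.val

theorem evalMat_mul (v : Fin 2 → ℂ) (M N : Matrix (Fin 2) (Fin 2) Poly) :
    evalMat v (M * N) = evalMat v M * evalMat v N := by
  simp [evalMat, Matrix.map_mul]

theorem evalMat_one (v : Fin 2 → ℂ) : evalMat v 1 = 1 := by
  simp [evalMat]

theorem Carries.one {m : Fin 2 → ℤ} {z₁ : ℂ} (x : QPH m z₁) : Carries 1 x x :=
  ⟨fun i => by simp [evalMat_one], by simp⟩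

theorem Carries.mul {m : Fin 2 → ℤ} {z₁ : ℂ} {g h : GL (Fin 2) Poly} {x y w : QPH m z₁}
    (hg : Carries g x y) (hh : Carries h y w) : Carries (h * g) x w := by
  refine ⟨fun i => ?_, ?_⟩
  · rw [hh.1 i, hg.1 i, Units.val_mul, evalMat_mul, Matrix.mulVecLin_mul, Submodule.map_comp]
  · rw [hh.2, hg.2, mul_inv_rev, Units.val_mul, Units.val_mul]
    simp only [mul_assoc]

theorem Carries.inv {m : Fin 2 → ℤ} {z₁ : ℂ} {g : GL (Fin 2) Poly} {x y : QPH m z₁}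
    (hg : Carries g x y) : Carries g⁻¹ y x := by
  refine ⟨fun i => ?_, ?_⟩
  · rw [hg.1 i, ← Submodule.map_comp, ← Matrix.mulVecLin_mul, ← evalMat_mul, Units.inv_mul,
      evalMat_one, Matrix.mulVecLin_one, Submodule.map_id]
  · rw [hg.2, inv_inv, mul_assoc, mul_assoc, mul_assoc, Units.inv_mul, mul_one, ← mul_assoc,
      Units.inv_mul, one_mul]

/-- The orbit relation on `QPH(E)`.  The centre of `Aut(E)` acts trivially, so the orbits of
`Aut(E)` are the orbits of `ℙ(Aut(E))`. -/
instance orbitSetoid (m : Fin 2 → ℤ) (z₁ : ℂ) : Setoid (QPH m z₁) where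
  r x y := ∃ g ∈ AutE m, Carries g x y
  iseqv :=
    { refl := fun x => ⟨1, one_mem _, Carries.one x⟩
      symm := fun ⟨g, hg, h⟩ => ⟨g⁻¹, inv_mem hg, h.inv⟩
      trans := fun ⟨g, hg, h⟩ ⟨g', hg', h'⟩ => ⟨g' * g, mul_mem hg' hg, h.mul h'⟩ }

/-- The set of `ℙ(Aut(E))`-orbits in `QPH(E)`. -/
def OrbitSpace (m : Fin 2 → ℤ) (z₁ : ℂ) : Type := Quotient (orbitSetoid m z₁)

/-- The orbit of a point. -/
def orb {m : Fin 2 → ℤ} {z₁ : ℂ} (x : QPH m z₁) : OrbitSpace m z₁ := Quotient.mk _ x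

/-! ### Weight polytopes and chambers

Parities are those of an integer `d`, the degree of the bundle. -/

/-- The number `|I|` as an integer. -/
def card (I : Finset (Fin 4)) : ℤ := (I.card : ℤ)

/-- The wall `ℋ_{I,k} = β_I⁻¹(k)` in `[0,1]⁴`. -/
def wall (I : Finset (Fin 4)) (k : ℤ) : Set (Fin 4 → ℝ) :=
  {β | (∀ i, β i ∈ Set.Icc (0 : ℝ) 1) ∧ betaSum I β = (k : ℝ)}

/-- The complement in `(0,1)⁴` of the semi-stability walls of the parity of `d`. -/
def wallComplement (d : ℤ) : Set (Fin 4 → ℝ) :=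
  {β | (∀ i, β i ∈ Set.Ioo (0 : ℝ) 1) ∧
    ∀ (I : Finset (Fin 4)) (k : ℤ), (k = card I - 1 ∨ k = card I - 2 ∨ k = card I - 3) →
      k ≡ d [ZMOD 2] → β ∉ wall I k}

/-- Open chambers: connected components of the complement of the walls. -/
def IsOpenChamber (d : ℤ) (C : Set (Fin 4 → ℝ)) : Prop :=
  ∃ β ∈ wallComplement d, C = connectedComponentIn (wallComplement d) β

/-- The polytope `ℬ₀` (for `d` even) or `ℬ₁` (for `d` odd). -/
def polytope (d : ℤ) : Set (Fin 4 → ℝ) :=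
  {β | (∀ i, β i ∈ Set.Icc (0 : ℝ) 1) ∧
    ∀ I : Finset (Fin 4), card I ≡ d + 1 [ZMOD 2] → betaSum I β ≤ ((card I - 1 : ℤ) : ℝ)}

/-- The vertex `v_I` of the cube, the point where `β_I = -|Iᶜ|`. -/
def vertex (I : Finset (Fin 4)) : Fin 4 → ℝ := fun i => if i ∈ I then 0 else 1

/-- Partition sets of the parity of `d`: sets of subsets of that parity which contain exactly one
of `I`, `Iᶜ` for each `I` of that parity. -/
def IsPartitionSet (d : ℤ) (𝓘 : Set (Finset (Fin 4))) : Prop :=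
  (∀ I ∈ 𝓘, card I ≡ d [ZMOD 2]) ∧
  ∀ I : Finset (Fin 4), card I ≡ d [ZMOD 2] → Xor (I ∈ 𝓘) (Iᶜ ∈ 𝓘)

/-- `C` is the interior chamber `𝒞_𝓘`: an open chamber inside the polytope that lies on the side
`β_I < |I| - 2` of the interior walls, for each `I` in the partition set `𝓘`. -/
def IsInteriorChamber (d : ℤ) (𝓘 : Set (Finset (Fin 4))) (C : Set (Fin 4 → ℝ)) : Prop :=
  IsOpenChamber d C ∧ C ⊆ polytope d ∧ IsPartitionSet d 𝓘 ∧
    ∀ I ∈ 𝓘, ∀ β ∈ C, betaSum I β < ((card I - 2 : ℤ) : ℝ)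

/-- `C` is the exterior chamber `𝒞_{I'}`: an open chamber not inside the polytope, whose closure
contains the boundary wall `ℋ_{I',|I'|-3}` of the parity of `d`. -/
def IsExteriorChamber (d : ℤ) (I' : Finset (Fin 4)) (C : Set (Fin 4 → ℝ)) : Prop :=
  IsOpenChamber d C ∧ ¬ C ⊆ polytope d ∧ card I' - 3 ≡ d [ZMOD 2] ∧
    wall I' (card I' - 3) ⊆ closure C

/-- `𝓘(I')`: the set of those `I` for which `v_I` lies on the boundary wall `ℋ_{I',|I'|-3}`. -/
def adjacentPartitionSet (I' : Finset (Fin 4)) : Set (Finset (Fin 4)) :=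
  {I | vertex I ∈ wall I' (card I' - 3)}

/-! ### Interpolation loci, nilpotent strata and basic building blocks -/

/-- The interpolation locus `B_{I,j}(E)`: some line sub-bundle of degree `j` interpolates the flags
over `I`.  If `m 1 < m 0` and `j = m 0`, the only such sub-bundle is the destabilizing one `E₁`, and
`B_{I,m 0}(E)` is the locus where `E₁` meets the flags exactly over `I`. -/
def interpLocus (m : Fin 2 → ℤ) (z₁ : ℂ) (I : Finset (Fin 4)) (j : ℤ) : Set QP :=
  {F | if m 1 < m 0 ∧ j = m 0 then ∃ L : LineSub m j, incidence z₁ L F = I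
    else ∃ L : LineSub m j, I ⊆ incidence z₁ L F}

/-- The locus `U(E)`. -/
def locusU (m : Fin 2 → ℤ) (z₁ : ℂ) : Set QP :=
  {F | ∀ I : Finset (Fin 4), ¬ (F ∈ interpLocus m z₁ I (m 0) ∧ F ∈ interpLocus m z₁ Iᶜ (m 1))}

/-- `𝒩_I`: the orbits in `ι(B_{I,j}(E) ∩ U(E))`.  Here `j` is determined by `2 j = d + 2 - |I|`,
so `𝒩_I` is defined for `|I| ≡ d` mod 2.  It is nonempty for `|I| = 2` (`j = m 0`) and
`|I| = 4` (`j = m 0 - 1`) if `m 0 = m 1`; for `|I| = 1` (`j = m 0`) and `|I| = 3` (`j = m 1`) if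
`m 0 - m 1 = 1`; and for `I = ∅` (`j = m 0`) if `m 0 - m 1 = 2`. -/
def pointN (m : Fin 2 → ℤ) (z₁ : ℂ) (I : Finset (Fin 4)) : Set (OrbitSpace m z₁) :=
  orb '' {x | x.Φ = 0 ∧ x.F ∈ locusU m z₁ ∧
    ∃ j : ℤ, 2 * j = deg m + 2 - card I ∧ x.F ∈ interpLocus m z₁ I j}

/-- Conditional stability: stability with respect to some open chamber of the parity of the
degree. -/
def IsCondStable {m : Fin 2 → ℤ} {z₁ : ℂ} (x : QPH m z₁) : Prop :=
  ∃ C, IsOpenChamber (deg m) C ∧ ∃ β ∈ C, IsStable β x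

/-- Nonzero nilpotent Higgs fields whose kernel line sub-bundle `L(Φ)` has degree `j` and meets
the flags exactly over `I`. -/
def nilpotentStratum (m : Fin 2 → ℤ) (z₁ : ℂ) (j : ℤ) (I : Finset (Fin 4)) : Set (QPH m z₁) :=
  {x | x.Φ ≠ 0 ∧ x.Φ.det = 0 ∧
    ∃ L : LineSub m j, x.Φ.mulVec L.s = 0 ∧ incidence z₁ L x.F = I}

/-- `R_I(E)`: here `L(Φ) = E₁`, the sub-bundle of degree `m 0` of an `E` with `m 1 < m 0`. -/
def stratumR (m : Fin 2 → ℤ) (z₁ : ℂ) (I : Finset (Fin 4)) : Set (QPH m z₁) :=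
  {x | m 1 < m 0 ∧ x ∈ nilpotentStratum m z₁ (m 0) I}

/-- `S_{I,j}(E)`: here `L(Φ)` has degree `j ≤ m 1`. -/
def stratumS (m : Fin 2 → ℤ) (z₁ : ℂ) (I : Finset (Fin 4)) (j : ℤ) : Set (QPH m z₁) :=
  {x | j ≤ m 1 ∧ x ∈ nilpotentStratum m z₁ j I}

/-- `𝒦_I`: the space of conditionally stable orbits in `R_I(E)`. -/
def blockK (m : Fin 2 → ℤ) (z₁ : ℂ) (I : Finset (Fin 4)) : Set (OrbitSpace m z₁) :=
  orb '' {x | x ∈ stratumR m z₁ I ∧ IsCondStable x}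

/-- `ℒ_I`: the space of conditionally stable orbits in `S_{I,j}(E)`.  It is empty unless `j = m 1`,
or `m 0 = m 1`, `j = m 1 - 1` and `|I| = 4`. -/
def blockL (m : Fin 2 → ℤ) (z₁ : ℂ) (I : Finset (Fin 4)) (j : ℤ) : Set (OrbitSpace m z₁) :=
  orb '' {x | x ∈ stratumS m z₁ I j ∧ IsCondStable x}

/-- `B` is an `I`-basic building block of `E`. -/
def IsBuildingBlock (m : Fin 2 → ℤ) (z₁ : ℂ) (I : Finset (Fin 4))
    (B : Set (OrbitSpace m z₁)) : Prop :=
  B = blockK m z₁ I ∨ ∃ j, B = blockL m z₁ I j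

end ParHiggs

end

noncomputable section

namespace ParHiggs

/-! ### Binary forms -/

/-! Write `vertexDist I β = |I| - β_I`, on the cube the `ℓ¹` distance from `β` to the indicator
vector of `I`. A sub-bundle `L` of degree `j` passes the test for `β` exactly when this distance,
for `I = I_L`, exceeds the integer threshold `|I_L| - (d - 2j)` (`betaSum_lt_iff`). Everything then
reduces to bounding thresholds and locating chambers among the vertices.

For a nonzero nilpotent `Φ` the kernel is the only invariant sub-bundle (`isStable_iff_of_kernel`).
The map `E/L → L ⊗ K(D)` vanishes at each flag not on `L`, so counting zeros gives threshold at
least 2 (`card_compl_incidence_le`). Conditional stability makes it less than 4. Parity of `|I|`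
decides between 2 and 3.

For `Φ = 0` every sub-bundle is tested. The interpolating one has threshold 2. Counting zeros of `s
∧ s'` bounds the flags it shares with another one (`card_inter_incidence_le`), and `U` removes the
only competitor that could also reach threshold 2.

In an interior chamber, vertices of parity `d + 1` are at distance between 1 and 3, and the vertices
of `𝓘` are those of parity `d` at distance above 2. In the exterior chamber of `I'`, the distance
from `I'` exceeds 3 (`IsExteriorChamber.three_lt`), and triangle inequalities settle every other
vertex. -/

theorem H0_eq_zero {n : ℤ} (hn : n < 0) {f : Poly} (hf : f ∈ H0 n) : f = 0 := by
  unfold H0 at hf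
  rwa [if_neg (by omega), Submodule.mem_bot] at hf

theorem H0_natCast {n : ℕ} {f : Poly} : f ∈ H0 (n : ℤ) ↔ f.IsHomogeneous n := by
  unfold H0
  rw [if_pos (by omega), Int.toNat_natCast, mem_homogeneousSubmodule]

theorem exists_isHomogeneous_of_mem_H0 {n : ℤ} {f : Poly} (hf : f ∈ H0 n) (h0 : f ≠ 0) :
    ∃ k : ℕ, n = k ∧ f.IsHomogeneous k := by
  have hn : 0 ≤ n := by
    by_contra h
    exact h0 (H0_eq_zero (by omega) hf)
  obtain ⟨k, rfl⟩ := Int.eq_ofNat_of_zero_le hn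
  exact ⟨k, rfl, H0_natCast.1 hf⟩

theorem H0_totalDegree {n : ℤ} {f : Poly} (hf : f ∈ H0 n) (h0 : f ≠ 0) :
    (f.totalDegree : ℤ) = n := by
  obtain ⟨k, rfl, hk⟩ := exists_isHomogeneous_of_mem_H0 hf h0
  rw [hk.totalDegree h0]

theorem H0_neg {n : ℤ} {f : Poly} (hf : f ∈ H0 n) : -f ∈ H0 n := Submodule.neg_mem _ hf

theorem H0_C (c : ℂ) : (C c : Poly) ∈ H0 0 := H0_natCast.2 (isHomogeneous_C _ c)

/-- A quotient of binary forms is a binary form. -/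
theorem H0_of_mul {p q : ℤ} {f u : Poly} (hf : f ∈ H0 p) (h0 : f ≠ 0) (h : f * u ∈ H0 q) :
    u ∈ H0 (q - p) := by
  by_cases hu : u = 0
  · rw [hu]
    exact Submodule.zero_mem _
  have hfu : f * u ≠ 0 := mul_ne_zero h0 hu
  have hp := H0_totalDegree hf h0
  have hq := H0_totalDegree h hfu
  have hd := totalDegree_mul_of_isDomain h0 hu
  obtain ⟨k, rfl, hk⟩ := exists_isHomogeneous_of_mem_H0 hf h0
  obtain ⟨l, rfl, hl⟩ := exists_isHomogeneous_of_mem_H0 h hfu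
  have hkl : k ≤ l := by omega
  obtain ⟨e, rfl⟩ := Nat.exists_eq_add_of_le hkl
  -- Comparing components of degree `k + e` gives `f * u = f * u_e`; cancelling `f` shows that `u`
  -- is its own component of degree `e`.
  let : GradedRing (homogeneousSubmodule (Fin 2) ℂ) := gradedAlgebra
  have h1 := DirectSum.coe_decompose_mul_add_of_left_mem (homogeneousSubmodule (Fin 2) ℂ)
    (i := k) (j := e) (a := f) (b := u) hk
  rw [DirectSum.decompose_of_mem_same _ (show f * u ∈ homogeneousSubmodule (Fin 2) ℂ (k + e) from hl)]
    at h1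
  have h2 := mul_left_cancel₀ h0 h1
  have h3 : (((k + e : ℕ) : ℤ) - (k : ℤ)) = (e : ℤ) := by push_cast; ring
  rw [h3, H0_natCast, h2]
  exact SetLike.coe_mem (DirectSum.decompose (homogeneousSubmodule (Fin 2) ℂ) u e)

theorem eval_smul_eq_zero {n : ℤ} {f : Poly} (hf : f ∈ H0 n) {v : Fin 2 → ℂ}
    (hv : eval v f = 0) (c : ℂ) : eval (c • v) f = 0 := by
  by_cases h0 : f = 0
  · simp [h0]
  obtain ⟨k, rfl, hk⟩ := exists_isHomogeneous_of_mem_H0 hf h0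
  have : eval (c • v) f = c ^ k * eval v f := by
    rw [eval_eq, eval_eq, Finset.mul_sum]
    refine Finset.sum_congr rfl fun d hd => ?_
    have hdk := hk.degree_eq_sum_deg_support hd
    have : ∏ i ∈ d.support, (c • v) i ^ d i = c ^ k * ∏ i ∈ d.support, v i ^ d i := by
      simp only [Pi.smul_apply, smul_eq_mul, mul_pow, Finset.prod_mul_distrib]
      rw [Finset.prod_pow_eq_pow_sum, hdk]
    rw [this]
    ring
  rw [this, hv, mul_zero]

/-- The linear form that vanishes at the point represented by `p`. -/
def linForm (p : Fin 2 → ℂ) : Poly := C (p 1) * X 0 - C (p 0) * X 1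

@[simp] theorem eval_linForm (p v : Fin 2 → ℂ) : eval v (linForm p) = p 1 * v 0 - p 0 * v 1 := by
  simp [linForm]

theorem linForm_isHomogeneous (p : Fin 2 → ℂ) : (linForm p).IsHomogeneous 1 :=
  (isHomogeneous_C_mul_X _ _).sub (isHomogeneous_C_mul_X _ _)

theorem linForm_ne_zero {p : Fin 2 → ℂ} (hp : p ≠ 0) : linForm p ≠ 0 := by
  intro h
  apply hp
  have h0 := eval_linForm p ![1, 0]
  have h1 := eval_linForm p ![0, 1]
  rw [h] at h0 h1
  ext i
  fin_cases i
  · simpa using h1.symm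
  · simpa using h0.symm

theorem linForm_prime {p : Fin 2 → ℂ} (hp : p ≠ 0) : Prime (linForm p) := by
  refine UniqueFactorizationMonoid.irreducible_iff_prime.1
    (irreducible_of_totalDegree_eq_one
      ((linForm_isHomogeneous p).totalDegree (linForm_ne_zero hp)) fun x hx => ?_)
  rw [isUnit_iff_ne_zero]
  rintro rfl
  apply linForm_ne_zero hp
  ext d
  simpa using hx d

/-- A point annihilated by `linForm p` is a multiple of `p`. -/
theorem exists_smul_of_wedge_eq_zero {p v : Fin 2 → ℂ} (hp : p ≠ 0)
    (h : p 1 * v 0 - p 0 * v 1 = 0) : ∃ c : ℂ, v = c • p := by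
  by_cases h0 : p 0 = 0
  · have h1 : p 1 ≠ 0 := by
      intro h1
      apply hp
      ext i
      fin_cases i <;> assumption
    refine ⟨v 1 / p 1, ?_⟩
    rw [h0] at h
    ext i
    fin_cases i
    · have : v 0 = 0 := by simpa [h1] using h
      simp [this, h0]
    · simp [h1]
  · refine ⟨v 0 / p 0, ?_⟩
    ext i
    fin_cases i
    · simp [h0]
    · simp only [Fin.mk_one, Pi.smul_apply, smul_eq_mul]
      field_simp
      linear_combination -h

/-- By homogeneity `f` vanishes on the whole line through `p`, which is the zero locus of `linForm
p`. The Nullstellensatz and primality of the linear form conclude. -/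
theorem linForm_dvd {n : ℤ} {f : Poly} (hf : f ∈ H0 n) {p : Fin 2 → ℂ} (hp : p ≠ 0)
    (hv : eval p f = 0) : linForm p ∣ f := by
  have hrad : f ∈ (Ideal.span {linForm p}).radical := by
    rw [← vanishingIdeal_zeroLocus_eq_radical (K := ℂ), mem_vanishingIdeal_iff]
    intro v hv'
    rw [zeroLocus_span] at hv'
    have h1 := hv' _ rfl
    change eval v (linForm p) = 0 at h1
    change eval v f = 0
    rw [eval_linForm] at h1
    obtain ⟨c, rfl⟩ := exists_smul_of_wedge_eq_zero hp h1
    exact eval_smul_eq_zero hf hv c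
  obtain ⟨N, hN⟩ := hrad
  exact (linForm_prime hp).dvd_of_dvd_pow (Ideal.mem_span_singleton.1 hN)

/-! ### The marked points -/

theorem pt_ne_zero (z₁ : ℂ) (i : Fin 4) : pt z₁ i ≠ 0 := by
  intro h
  have h0 := congrFun h 0
  have h1 := congrFun h 1
  fin_cases i <;> simp [pt] at h0 h1

theorem pt_wedge_ne_zero {z₁ : ℂ} (hz₀ : z₁ ≠ 0) (hz₁ : z₁ ≠ 1) {i k : Fin 4} (hik : i ≠ k) :
    pt z₁ i 1 * pt z₁ k 0 - pt z₁ i 0 * pt z₁ k 1 ≠ 0 := by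
  have h1 : (1 : ℂ) - z₁ ≠ 0 := sub_ne_zero.2 hz₁.symm
  have h2 : z₁ - 1 ≠ 0 := sub_ne_zero.2 hz₁
  fin_cases i <;> fin_cases k <;> first | exact absurd rfl hik | simp [pt, hz₀, h1, h2]

/-- A nonzero binary form of degree `n` vanishes at no more than `n` of the marked points. -/
theorem card_le_of_vanishes {z₁ : ℂ} (hz₀ : z₁ ≠ 0) (hz₁ : z₁ ≠ 1) {n : ℤ} {f : Poly}
    (hf : f ∈ H0 n) (h0 : f ≠ 0) {S : Finset (Fin 4)} (hS : ∀ i ∈ S, eval (pt z₁ i) f = 0) :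
    card S ≤ n := by
  have hdvd : ∏ i ∈ S, linForm (pt z₁ i) ∣ f := by
    refine Finset.prod_dvd_of_isRelPrime ?_ fun i hi => linForm_dvd hf (pt_ne_zero z₁ i) (hS i hi)
    intro i _ k _ hik
    refine (linForm_prime (pt_ne_zero z₁ i)).irreducible.isRelPrime_iff_not_dvd.2 ?_
    rintro ⟨g, hg⟩
    have := congrArg (eval (pt z₁ i)) hg
    rw [map_mul, eval_linForm, eval_linForm] at this
    apply pt_wedge_ne_zero hz₀ hz₁ hik
    linear_combination -this
  have hne : ∏ i ∈ S, linForm (pt z₁ i) ≠ 0 :=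
    Finset.prod_ne_zero_iff.2 fun i _ => linForm_ne_zero (pt_ne_zero z₁ i)
  have hdeg : (∏ i ∈ S, linForm (pt z₁ i)).totalDegree = S.card := by
    have := IsHomogeneous.prod S (fun i => linForm (pt z₁ i)) (fun _ => 1)
      fun i _ => linForm_isHomogeneous _
    rw [this.totalDegree hne]
    simp
  have h1 := totalDegree_le_of_dvd_of_isDomain hdvd h0
  have h2 := H0_totalDegree hf h0
  unfold card
  omega

/-! ### Flags -/

/-- Since `v` spans the line `P`, membership is the vanishing of a 2×2 determinant. This turns
incidences with flags into zeros of binary forms. -/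
theorem mem_flag_iff (P : ℙ ℂ (Fin 2 → ℂ)) {v w : Fin 2 → ℂ} (hv : v ≠ 0) (hvP : v ∈ P.submodule) :
    w ∈ P.submodule ↔ v 0 * w 1 - v 1 * w 0 = 0 := by
  rw [Projectivization.submodule_eq, Submodule.mem_span_singleton] at *
  obtain ⟨a, rfl⟩ := hvP
  have ha : a ≠ 0 := by
    rintro rfl
    simp at hv
  constructor
  · rintro ⟨b, rfl⟩
    simp
    ring
  · intro h
    obtain ⟨c, rfl⟩ := exists_smul_of_wedge_eq_zero (v := w) hv (by linear_combination -h)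
    exact ⟨c * a, by rw [mul_smul]⟩

/-! ### Line sub-bundles -/

section LineSubBundles

variable {m : Fin 2 → ℤ} {j j' : ℤ}

theorem LineSub.fibre_ne_zero (L : LineSub m j) {v : Fin 2 → ℂ} (hv : v ≠ 0) : L.fibre v ≠ 0 := by
  obtain ⟨a, ha⟩ := L.nowhere_zero v hv
  exact fun h => ha (congrFun h a)

theorem mem_incidence {z₁ : ℂ} {L : LineSub m j} {F : QP} {i : Fin 4} :
    i ∈ incidence z₁ L F ↔ L.fibre (pt z₁ i) ∈ (F i).submodule := by
  simp [incidence]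

/-- The only possible common zero is the origin, where the coordinates vanish too, so the
Nullstellensatz applies. -/
theorem exists_X_pow_mem {f g : Poly}
    (h : ∀ v : Fin 2 → ℂ, v ≠ 0 → eval v f ≠ 0 ∨ eval v g ≠ 0) (a : Fin 2) :
    ∃ N : ℕ, (X a : Poly) ^ N ∈ Ideal.span {f, g} := by
  change X a ∈ (Ideal.span {f, g}).radical
  rw [← vanishingIdeal_zeroLocus_eq_radical (K := ℂ), mem_vanishingIdeal_iff]
  intro v hv
  rw [zeroLocus_span] at hv
  have hf : eval v f = 0 := hv f (by simp)
  have hg : eval v g = 0 := hv g (by simp)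
  have hv0 : v = 0 := by
    by_contra hv0
    rcases h v hv0 with h | h
    · exact h hf
    · exact h hg
  rw [hv0, aeval_X, Pi.zero_apply]

/-- Two polynomials without a common zero outside of the origin are relatively prime. -/
theorem isRelPrime_of_nowhere_zero {f g : Poly}
    (h : ∀ v : Fin 2 → ℂ, v ≠ 0 → eval v f ≠ 0 ∨ eval v g ≠ 0) : IsRelPrime f g := by
  intro p hf hg
  have hp : ∀ a : Fin 2, ∃ N : ℕ, p ∣ X a ^ N := by
    intro a
    obtain ⟨N, hN⟩ := exists_X_pow_mem h a
    obtain ⟨x, y, hxy⟩ := Ideal.mem_span_pair.1 hN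
    refine ⟨N, ?_⟩
    rw [← hxy]
    exact dvd_add (hf.mul_left _) (hg.mul_left _)
  obtain ⟨N, hN⟩ := hp 0
  obtain ⟨M, hM⟩ := hp 1
  have hX : IsRelPrime (X 0 : Poly) (X 1) := by
    refine (X_prime (R := ℂ) (i := (0 : Fin 2))).irreducible.isRelPrime_iff_not_dvd.2 ?_
    rintro ⟨g, hg⟩
    simpa using congrArg (eval ![0, 1]) hg
  exact hX.pow hN hM

theorem LineSub.isRelPrime (L : LineSub m j) : IsRelPrime (L.s 0) (L.s 1) :=
  isRelPrime_of_nowhere_zero fun v hv => by simpa [Fin.exists_fin_two] using L.nowhere_zero v hv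

/-- The section `s ∧ s'` of `𝒪(d - j - j')`. -/
def wedge (L : LineSub m j) (L' : LineSub m j') : Poly := L.s 0 * L'.s 1 - L.s 1 * L'.s 0

theorem wedge_mem (L : LineSub m j) (L' : LineSub m j') : wedge L L' ∈ H0 (deg m - j - j') := by
  have h0 := H0_mul (L.mem 0) (L'.mem 1)
  have h1 := H0_mul (L.mem 1) (L'.mem 0)
  rw [show m 0 - j + (m 1 - j') = deg m - j - j' by unfold deg; ring] at h0
  rw [show m 1 - j + (m 0 - j') = deg m - j - j' by unfold deg; ring] at h1
  exact Submodule.sub_mem _ h0 h1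

theorem eval_wedge (L : LineSub m j) (L' : LineSub m j') (v : Fin 2 → ℂ) :
    eval v (wedge L L') = L.fibre v 0 * L'.fibre v 1 - L.fibre v 1 * L'.fibre v 0 := by
  simp [wedge, LineSub.fibre]

/-- Different line sub-bundles cannot meet in too many flags. -/
theorem card_inter_incidence_le {z₁ : ℂ} (hz₀ : z₁ ≠ 0) (hz₁ : z₁ ≠ 1) {L : LineSub m j}
    {L' : LineSub m j'} (h : wedge L L' ≠ 0) (F : QP) :
    card (incidence z₁ L F ∩ incidence z₁ L' F) ≤ deg m - j - j' := by
  refine card_le_of_vanishes hz₀ hz₁ (wedge_mem L L') h fun i hi => ?_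
  rw [Finset.mem_inter, mem_incidence, mem_incidence] at hi
  rw [eval_wedge]
  exact (mem_flag_iff (F i) (L.fibre_ne_zero (pt_ne_zero z₁ i)) hi.1).1 hi.2

theorem incidence_subset_of_wedge {z₁ : ℂ} {L : LineSub m j} {L' : LineSub m j'}
    (h : wedge L L' = 0) (F : QP) : incidence z₁ L F ⊆ incidence z₁ L' F := by
  intro i hi
  rw [mem_incidence] at *
  rw [mem_flag_iff (F i) (L.fibre_ne_zero (pt_ne_zero z₁ i)) hi, ← eval_wedge, h, map_zero]

theorem wedge_swap (L : LineSub m j) (L' : LineSub m j') : wedge L' L = -wedge L L' := by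
  unfold wedge
  ring

theorem incidence_eq_of_wedge {z₁ : ℂ} {L : LineSub m j} {L' : LineSub m j'}
    (h : wedge L L' = 0) (F : QP) : incidence z₁ L F = incidence z₁ L' F :=
  (incidence_subset_of_wedge h F).antisymm
    (incidence_subset_of_wedge (by rw [wedge_swap, h, neg_zero]) F)

theorem dvd_of_wedge {L : LineSub m j} {L' : LineSub m j'} (h : wedge L L' = 0) (a : Fin 2) :
    L.s a ∣ L'.s a := by
  unfold wedge at h
  fin_cases a
  · refine L.isRelPrime.dvd_of_dvd_mul_left (z := L'.s 0) ⟨L'.s 1, ?_⟩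
    linear_combination -h
  · refine L.isRelPrime.symm.dvd_of_dvd_mul_left (z := L'.s 1) ⟨L'.s 0, ?_⟩
    linear_combination h

theorem exists_s_ne_zero (L : LineSub m j) : ∃ a, L.s a ≠ 0 := by
  obtain ⟨a, ha⟩ := L.nowhere_zero 1 one_ne_zero
  exact ⟨a, fun h => ha (by rw [h, map_zero])⟩

/-- Proportional line sub-bundles have the same degree. -/
theorem degree_eq_of_wedge {L : LineSub m j} {L' : LineSub m j'} (h : wedge L L' = 0) :
    j = j' := by
  obtain ⟨a, ha⟩ := exists_s_ne_zero L
  have h1 := dvd_of_wedge h a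
  have h2 := dvd_of_wedge (show wedge L' L = 0 by rw [wedge_swap, h, neg_zero]) a
  have ha' : L'.s a ≠ 0 := fun h0 => ha (zero_dvd_iff.1 (h0 ▸ h2))
  have d1 := totalDegree_le_of_dvd_of_isDomain h1 ha'
  have d2 := totalDegree_le_of_dvd_of_isDomain h2 ha
  have e1 := H0_totalDegree (L.mem a) ha
  have e2 := H0_totalDegree (L'.mem a) ha'
  omega

/-- The degree of a line sub-bundle of `𝒪(m 0) ⊕ 𝒪(m 1)` is `m 0` or at most `m 1`. -/
theorem LineSub.degree_eq_or_le (L : LineSub m j) : j = m 0 ∨ j ≤ m 1 := by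
  by_contra! hj
  have h1 : L.s 1 = 0 := H0_eq_zero (by omega) (L.mem 1)
  have h0 : L.s 0 ≠ 0 := by
    obtain ⟨a, ha⟩ := exists_s_ne_zero L
    fin_cases a
    · exact ha
    · exact absurd h1 ha
  -- With second component zero, coprimality makes the first a unit, hence of degree 0, which forces
  -- `j = m 0`.
  have hu : IsUnit (L.s 0) := L.isRelPrime dvd_rfl (h1 ▸ dvd_zero _)
  have e := H0_totalDegree (L.mem 0) h0
  have := totalDegree_le_of_dvd_of_isDomain hu.dvd (one_ne_zero (α := Poly))
  rw [totalDegree_one] at this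
  omega

/-- The sub-bundle `𝒪(m 0)` of `𝒪(m 0) ⊕ 𝒪(m 1)`. -/
def firstSummand (m : Fin 2 → ℤ) : LineSub m (m 0) where
  s := ![1, 0]
  mem a := by
    fin_cases a
    · simpa using H0_one
    · simp
  nowhere_zero v _ := ⟨0, by simp⟩

/-- The sub-bundle of `𝒪(n) ⊕ 𝒪(n)` with a given fibre. -/
def constantSub {n : ℤ} (hm : ∀ a, m a = n) (w : Fin 2 → ℂ) (hw : w ≠ 0) : LineSub m n where
  s a := C (w a)
  mem a := by
    rw [hm a, sub_self]
    exact H0_C _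
  nowhere_zero v _ := by
    obtain ⟨a, ha⟩ := Function.ne_iff.1 hw
    exact ⟨a, by simpa using ha⟩

/-! ### Stability is constant on orbits -/

variable {z₁ : ℂ}

/-- The image of a line sub-bundle under an automorphism. -/
def LineSub.map (L : LineSub m j) (g : GL (Fin 2) Poly) (hg : g ∈ AutE m) : LineSub m j where
  s := g.val.mulVec L.s
  mem a := by
    change ∑ b, g.val a b * L.s b ∈ _
    refine Submodule.sum_mem _ fun b _ => ?_
    have := H0_mul (hg.1 a b) (L.mem b)
    rwa [sub_add_sub_cancel] at this
  nowhere_zero v hv := by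
    by_contra! h
    obtain ⟨a, ha⟩ := L.nowhere_zero v hv
    apply ha
    have h1 : L.s = g⁻¹.val.mulVec (g.val.mulVec L.s) := by
      rw [Matrix.mulVec_mulVec, Units.inv_mul, Matrix.one_mulVec]
    rw [h1]
    simp only [Matrix.mulVec, dotProduct, map_sum, map_mul] at h ⊢
    refine Finset.sum_eq_zero fun b _ => ?_
    rw [h b, mul_zero]

theorem LineSub.fibre_map (L : LineSub m j) {g : GL (Fin 2) Poly} (hg : g ∈ AutE m)
    (v : Fin 2 → ℂ) : (L.map g hg).fibre v = (evalMat v g.val).mulVec (L.fibre v) := by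
  ext a
  fin_cases a <;> simp [LineSub.map, LineSub.fibre, Matrix.mulVec, dotProduct, evalMat]

theorem incidence_subset_incidence_map (L : LineSub m j) {g : GL (Fin 2) Poly} (hg : g ∈ AutE m)
    {x y : QPH m z₁} (h : Carries g x y) :
    incidence z₁ L x.F ⊆ incidence z₁ (L.map g hg) y.F := by
  intro i hi
  rw [mem_incidence] at *
  rw [h.1 i, LineSub.fibre_map]
  exact Submodule.mem_map_of_mem (f := Matrix.mulVecLin (evalMat (pt z₁ i) g.val)) hi

theorem LineSub.map_inv_s (L : LineSub m j) {g : GL (Fin 2) Poly} (hg : g ∈ AutE m) :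
    ((L.map g hg).map g⁻¹ (inv_mem hg)).s = L.s := by
  simp only [LineSub.map]
  rw [Matrix.mulVec_mulVec, Units.inv_mul, Matrix.one_mulVec]

theorem incidence_map (L : LineSub m j) {g : GL (Fin 2) Poly} (hg : g ∈ AutE m)
    {x y : QPH m z₁} (h : Carries g x y) :
    incidence z₁ (L.map g hg) y.F = incidence z₁ L x.F := by
  refine Finset.Subset.antisymm ?_ (incidence_subset_incidence_map L hg h)
  have h1 := incidence_subset_incidence_map (L.map g hg) (inv_mem hg) h.inv
  refine h1.trans_eq ?_
  ext i
  rw [mem_incidence, mem_incidence]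
  unfold LineSub.fibre
  rw [L.map_inv_s hg]

theorem IsInvariant.map {L : LineSub m j} {g : GL (Fin 2) Poly} (hg : g ∈ AutE m)
    {x y : QPH m z₁} (h : Carries g x y) (hL : IsInvariant x.Φ L) :
    IsInvariant y.Φ (L.map g hg) := by
  obtain ⟨f, hf, hfs⟩ := hL
  refine ⟨f, hf, ?_⟩
  simp only [LineSub.map]
  rw [h.2, Matrix.mulVec_mulVec, mul_assoc, Units.inv_mul, mul_one, ← Matrix.mulVec_mulVec, hfs,
    Matrix.mulVec_smul]

theorem IsStable.of_carries {β : Fin 4 → ℝ} {g : GL (Fin 2) Poly} (hg : g ∈ AutE m)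
    {x y : QPH m z₁} (h : Carries g x y) (hy : IsStable β y) : IsStable β x := by
  intro j L hL
  have := hy j (L.map g hg) (hL.map hg h)
  rwa [incidence_map L hg h] at this

theorem isStable_iff_of_orb_eq {β : Fin 4 → ℝ} {x y : QPH m z₁} (h : orb x = orb y) :
    IsStable β x ↔ IsStable β y := by
  obtain ⟨g, hg, hgxy⟩ := Quotient.exact h
  exact ⟨fun hx => hx.of_carries (inv_mem hg) hgxy.inv, fun hy => hy.of_carries hg hgxy⟩

end LineSubBundles

/-! ### Nilpotent Higgs fields -/

section Higgs

variable {m : Fin 2 → ℤ} {z₁ : ℂ} {j j' : ℤ}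

/-- Nilpotent residues make the trace, a form of degree 2, vanish at four points. -/
theorem QPH.trace_eq_zero (hz₀ : z₁ ≠ 0) (hz₁ : z₁ ≠ 1) (x : QPH m z₁) :
    x.Φ 0 0 + x.Φ 1 1 = 0 := by
  by_contra h
  have h0 := x.mem 0 0
  have h1 := x.mem 1 1
  rw [sub_self, zero_add] at h0 h1
  have := card_le_of_vanishes hz₀ hz₁ (Submodule.add_mem _ h0 h1) h (S := Finset.univ) fun i _ => by
    have := Matrix.isNilpotent_trace_of_isNilpotent (x.nilpotent i)
    rw [Matrix.trace_fin_two, isNilpotent_iff_eq_zero] at this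
    simpa [evalMat] using this
  simp [card] at this

/-- A nonzero Higgs field with kernel `L` is `v ↦ u (s ∧ v) s`. -/
theorem exists_eq_of_kernel (hz₀ : z₁ ≠ 0) (hz₁ : z₁ ≠ 1) {x : QPH m z₁} (hΦ : x.Φ ≠ 0)
    {L : LineSub m j} (hL : x.Φ.mulVec L.s = 0) :
    ∃ u : Poly, u ≠ 0 ∧ ∀ a, x.Φ a 0 = -(u * L.s a * L.s 1) ∧ x.Φ a 1 = u * L.s a * L.s 0 := by
  have htr := x.trace_eq_zero hz₀ hz₁
  have hk : ∀ a, x.Φ a 0 * L.s 0 + x.Φ a 1 * L.s 1 = 0 := fun a => by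
    simpa [Matrix.mulVec, dotProduct] using congrFun hL a
  -- Each row annihilates `s`, whose components are coprime, so it is a multiple of `(-s₁, s₀)`. If
  -- `s₀ = 0` it cannot be cancelled, but then `s₁` is a unit.
  have hrow : ∀ a, ∃ r, x.Φ a 0 = -(r * L.s 1) ∧ x.Φ a 1 = r * L.s 0 := by
    intro a
    have hcop := L.isRelPrime
    by_cases h0 : L.s 0 = 0
    · have hu : IsUnit (L.s 1) := hcop (h0 ▸ dvd_zero _) dvd_rfl
      obtain ⟨w, hw⟩ := hu.exists_right_inv
      refine ⟨-(x.Φ a 0 * w), ?_, ?_⟩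
      · linear_combination -(x.Φ a 0) * hw
      · have h1 := hk a
        rw [h0, mul_zero, zero_add] at h1
        rw [h0, mul_zero]
        exact (mul_eq_zero.1 h1).resolve_right hu.ne_zero
    · obtain ⟨r, hr⟩ := hcop.dvd_of_dvd_mul_left (z := x.Φ a 1)
        ⟨-x.Φ a 0, by linear_combination hk a⟩
      refine ⟨r, ?_, by rw [hr]; ring⟩
      refine mul_right_cancel₀ h0 ?_
      linear_combination hk a - L.s 1 * hr
  choose r hr using hrow
  -- Vanishing trace says that the column of multipliers `r` is proportional to `s`; coprimality
  -- again extracts the factor `u`.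
  have hr01 : r 0 * L.s 1 = r 1 * L.s 0 := by
    linear_combination -htr + (hr 0).1 + (hr 1).2
  have hu : ∃ u, ∀ a, r a = u * L.s a := by
    have hcop := L.isRelPrime
    by_cases h0 : L.s 0 = 0
    · have hu : IsUnit (L.s 1) := hcop (h0 ▸ dvd_zero _) dvd_rfl
      obtain ⟨w, hw⟩ := hu.exists_right_inv
      refine ⟨r 1 * w, Fin.forall_fin_two.2 ⟨?_, ?_⟩⟩
      · rw [h0, mul_zero] at hr01
        rw [h0, mul_zero]
        exact (mul_eq_zero.1 hr01).resolve_right hu.ne_zero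
      · linear_combination -(r 1) * hw
    · obtain ⟨u, hu⟩ := hcop.dvd_of_dvd_mul_left (z := r 0) ⟨r 1, by linear_combination hr01⟩
      refine ⟨u, Fin.forall_fin_two.2 ⟨by rw [hu]; ring, ?_⟩⟩
      refine mul_right_cancel₀ h0 ?_
      linear_combination -hr01 + L.s 1 * hu
  obtain ⟨u, hu⟩ := hu
  have hΦu : ∀ a, x.Φ a 0 = -(u * L.s a * L.s 1) ∧ x.Φ a 1 = u * L.s a * L.s 0 := fun a => by
    rw [← hu a]
    exact hr a
  refine ⟨u, ?_, hΦu⟩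
  rintro rfl
  apply hΦ
  ext1 a b
  fin_cases b
  · simpa using (hΦu a).1
  · simpa using (hΦu a).2

/-- The kernel is the only invariant line sub-bundle of a nonzero nilpotent Higgs field. -/
theorem wedge_eq_zero_of_isInvariant (hz₀ : z₁ ≠ 0) (hz₁ : z₁ ≠ 1) {x : QPH m z₁} (hΦ : x.Φ ≠ 0)
    {L : LineSub m j} (hL : x.Φ.mulVec L.s = 0) {L' : LineSub m j'} (hL' : IsInvariant x.Φ L') :
    wedge L L' = 0 := by
  obtain ⟨u, hu0, hu⟩ := exists_eq_of_kernel hz₀ hz₁ hΦ hL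
  obtain ⟨f, -, hf⟩ := hL'
  have hf' : ∀ a, x.Φ a 0 * L'.s 0 + x.Φ a 1 * L'.s 1 = f * L'.s a := fun a => by
    simpa [Matrix.mulVec, dotProduct] using congrFun hf a
  have h0 := hf' 0
  have h1 := hf' 1
  rw [(hu _).1, (hu _).2] at h0 h1
  -- Wedge `Φ s' = u (s ∧ s') s` with `s'`: the left side dies because `Φ s' = f s'`.
  have : u * wedge L L' * wedge L L' = 0 := by
    unfold wedge
    linear_combination L'.s 1 * h0 - L'.s 0 * h1
  simpa [hu0] using this

/-- The map `E/L → L ⊗ K(D)` induced by a Higgs field with kernel `L` vanishes at the flags that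
do not meet `L`. -/
theorem card_compl_incidence_le (hz₀ : z₁ ≠ 0) (hz₁ : z₁ ≠ 1) {x : QPH m z₁} (hΦ : x.Φ ≠ 0)
    {L : LineSub m j} (hL : x.Φ.mulVec L.s = 0) :
    card (incidence z₁ L x.F)ᶜ ≤ 2 * j - deg m + 2 := by
  obtain ⟨u, hu0, hu⟩ := exists_eq_of_kernel hz₀ hz₁ hΦ hL
  have hmem : u ∈ H0 (2 * j - deg m + 2) := by
    obtain ⟨a, ha⟩ := exists_s_ne_zero L
    have hsq := H0_mul (L.mem a) (L.mem a)
    -- The off-diagonal entry in row `a` is `± s_a² u`; dividing by the nonzero square reads off the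
    -- degree of `u`.
    have key : ∀ b, L.s a * L.s a * u ∈ H0 (m a - m b + 2) → deg m = m a + m b →
        u ∈ H0 (2 * j - deg m + 2) := by
      intro b hb hd
      have := H0_of_mul hsq (mul_ne_zero ha ha) hb
      rwa [show m a - m b + 2 - (m a - j + (m a - j)) = 2 * j - deg m + 2 by rw [hd]; ring] at this
    fin_cases a
    · refine key 1 ?_ rfl
      have := x.mem 0 1
      rw [(hu 0).2] at this
      convert! this using 1
      simp only [Fin.zero_eta]
      ring
    · refine key 0 ?_ (add_comm _ _)
      have := H0_neg (x.mem 1 0)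
      rw [(hu 1).1] at this
      convert! this using 1
      simp only [Fin.mk_one]
      ring
  refine card_le_of_vanishes hz₀ hz₁ hmem hu0 fun i hi => ?_
  rw [Finset.mem_compl, mem_incidence] at hi
  set P := x.F i
  have hrep : P.rep ∈ P.submodule := by
    rw [Projectivization.submodule_eq]
    exact Submodule.mem_span_singleton_self _
  rw [mem_flag_iff P P.rep_nonzero hrep] at hi
  have hker := x.ker i P.rep hrep
  obtain ⟨a, ha⟩ := L.nowhere_zero _ (pt_ne_zero z₁ i)
  have h1 := congrFun hker a
  have h2 : eval (pt z₁ i) (x.Φ a 0) * P.rep 0 + eval (pt z₁ i) (x.Φ a 1) * P.rep 1 = 0 := by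
    simpa [Matrix.mulVec, dotProduct, evalMat] using h1
  rw [(hu a).1, (hu a).2] at h2
  simp only [map_neg, map_mul] at h2
  -- The field sends the flag vector to `u (s ∧ v) s`, which must be zero. Both `s` and `s ∧ v` are
  -- nonzero here, so `u` vanishes.
  have h3 : eval (pt z₁ i) u * eval (pt z₁ i) (L.s a) *
      (P.rep 0 * L.fibre (pt z₁ i) 1 - P.rep 1 * L.fibre (pt z₁ i) 0) = 0 := by
    unfold LineSub.fibre
    linear_combination -h2
  exact (mul_eq_zero.1 ((mul_eq_zero.1 h3).resolve_right hi)).resolve_right ha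

/-- A nonzero nilpotent Higgs bundle is tested by its kernel alone. -/
theorem isStable_iff_of_kernel (hz₀ : z₁ ≠ 0) (hz₁ : z₁ ≠ 1) {x : QPH m z₁} (hΦ : x.Φ ≠ 0)
    {L : LineSub m j} (hL : x.Φ.mulVec L.s = 0) (β : Fin 4 → ℝ) :
    IsStable β x ↔ betaSum (incidence z₁ L x.F) β < ((deg m - 2 * j : ℤ) : ℝ) := by
  constructor
  · exact fun h => h j L ⟨0, Submodule.zero_mem _, by rw [hL, zero_smul]⟩
  · intro h j' L' hL'
    have hw := wedge_eq_zero_of_isInvariant hz₀ hz₁ hΦ hL hL'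
    obtain rfl := degree_eq_of_wedge hw
    rwa [← incidence_eq_of_wedge hw]

end Higgs

/-! ### Weights and chambers -/

section Chambers

variable {d : ℤ} {β : Fin 4 → ℝ}

/-- The distance `|I| - β_I` of `β` from the vertex of the cube where `β_I = |I|`. -/
def vertexDist (I : Finset (Fin 4)) (β : Fin 4 → ℝ) : ℝ := (card I : ℝ) - betaSum I β

/-- On the cube each summand is `|β i - 1_I i|`, which exhibits the `ℓ¹` distance. -/
theorem vertexDist_eq_sum (I : Finset (Fin 4)) (β : Fin 4 → ℝ) :
    vertexDist I β = ∑ i, if i ∈ I then 1 - β i else β i := by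
  have h1 : ∑ i ∈ I, (if i ∈ I then 1 - β i else β i) = ∑ i ∈ I, (1 - β i) :=
    Finset.sum_congr rfl fun i hi => if_pos hi
  have h2 : ∑ i ∈ Iᶜ, (if i ∈ I then 1 - β i else β i) = ∑ i ∈ Iᶜ, β i :=
    Finset.sum_congr rfl fun i hi => if_neg (Finset.mem_compl.1 hi)
  rw [← Finset.sum_add_sum_compl I, h1, h2]
  simp [vertexDist, betaSum, card]
  ring

theorem card_add_card_compl (I : Finset (Fin 4)) : card I + card Iᶜ = 4 := by
  have := Finset.card_add_card_compl I
  simp only [Fintype.card_fin] at this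
  unfold card
  omega

theorem betaSum_compl (I : Finset (Fin 4)) (β : Fin 4 → ℝ) : betaSum Iᶜ β = -betaSum I β := by
  simp [betaSum]

theorem vertexDist_compl (I : Finset (Fin 4)) (β : Fin 4 → ℝ) :
    vertexDist Iᶜ β = 4 - vertexDist I β := by
  have h : (card I : ℝ) + card Iᶜ = 4 := by exact_mod_cast card_add_card_compl I
  unfold vertexDist
  rw [betaSum_compl]
  linarith

theorem vertexDist_pos (hβ : ∀ i, β i ∈ Set.Ioo (0 : ℝ) 1) (I : Finset (Fin 4)) :
    0 < vertexDist I β := by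
  rw [vertexDist_eq_sum]
  refine Finset.sum_pos (fun i _ => ?_) Finset.univ_nonempty
  have := hβ i
  split_ifs
  · linarith [this.2]
  · exact this.1

theorem vertexDist_lt_four (hβ : ∀ i, β i ∈ Set.Ioo (0 : ℝ) 1) (I : Finset (Fin 4)) :
    vertexDist I β < 4 := by
  linarith [vertexDist_pos hβ Iᶜ, vertexDist_compl I β]

/-- The number of elements in which `I` and `J` differ. -/
def diffCard (I J : Finset (Fin 4)) : ℤ := card (symmDiff I J)

theorem diffCard_add_two_mul (I J : Finset (Fin 4)) :
    diffCard I J + 2 * card (I ∩ J) = card I + card J := by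
  have h1 := Finset.card_sdiff_add_card_inter I J
  have h2 := Finset.card_sdiff_add_card_inter J I
  rw [Finset.inter_comm J I] at h2
  have h3 : (symmDiff I J).card = (I \ J).card + (J \ I).card := by
    rw [symmDiff_def, Finset.sup_eq_union, Finset.card_union_of_disjoint disjoint_sdiff_sdiff]
  unfold diffCard card
  omega

/-- The triangle inequality: the vertices of `I` and `J` are at `ℓ¹` distance `diffCard I J`. -/
theorem vertexDist_le_add_diffCard (hβ : ∀ i, β i ∈ Set.Ioo (0 : ℝ) 1) (I J : Finset (Fin 4)) :
    vertexDist J β ≤ vertexDist I β + diffCard I J := by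
  have h : (diffCard I J : ℝ) = ∑ i, if i ∈ symmDiff I J then (1 : ℝ) else 0 := by
    simp [diffCard, card]
  rw [h, vertexDist_eq_sum, vertexDist_eq_sum, ← Finset.sum_add_distrib]
  refine Finset.sum_le_sum fun i _ => ?_
  have h0 := (hβ i).1
  have h1 := (hβ i).2
  by_cases hI : i ∈ I <;> by_cases hJ : i ∈ J <;> simp [Finset.mem_symmDiff, hI, hJ] <;> linarith

theorem diffCard_compl_left (I J : Finset (Fin 4)) : diffCard Iᶜ J = 4 - diffCard I J := by
  have h1 := diffCard_add_two_mul I J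
  have h2 := diffCard_add_two_mul Iᶜ J
  have h3 := card_add_card_compl I
  have h4 : card (I ∩ J) + card (Iᶜ ∩ J) = card J := by
    have := Finset.card_sdiff_add_card_inter J I
    rw [Finset.inter_comm J I, Finset.sdiff_eq_inter_compl, Finset.inter_comm J Iᶜ] at this
    unfold card
    omega
  omega

theorem diffCard_comm (I J : Finset (Fin 4)) : diffCard I J = diffCard J I := by
  rw [diffCard, diffCard, symmDiff_comm]

theorem diffCard_nonneg (I J : Finset (Fin 4)) : 0 ≤ diffCard I J := by
  unfold diffCard card
  omega

theorem diffCard_le_four (I J : Finset (Fin 4)) : diffCard I J ≤ 4 := by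
  have := diffCard_compl_left I J
  have := diffCard_nonneg Iᶜ J
  omega

theorem diffCard_eq_zero {I J : Finset (Fin 4)} : diffCard I J = 0 ↔ I = J := by
  unfold diffCard card
  rw [Int.natCast_eq_zero, Finset.card_eq_zero]
  exact symmDiff_eq_bot

theorem diffCard_le_add_vertexDist (hβ : ∀ i, β i ∈ Set.Ioo (0 : ℝ) 1) (I J : Finset (Fin 4)) :
    (diffCard I J : ℝ) ≤ vertexDist I β + vertexDist J β := by
  have h1 := vertexDist_le_add_diffCard hβ Iᶜ J
  have h2 := vertexDist_le_add_diffCard hβ I Jᶜ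
  rw [diffCard_comm, diffCard_compl_left, diffCard_comm, vertexDist_compl] at h2
  push_cast at h2
  linarith

/-- Used with `k = deg m - 2 * j`, so that `card I - k` is the threshold of a sub-bundle of degree
`j`. -/
theorem betaSum_lt_iff (I : Finset (Fin 4)) (β : Fin 4 → ℝ) (k : ℤ) :
    betaSum I β < (k : ℝ) ↔ ((card I - k : ℤ) : ℝ) < vertexDist I β := by
  unfold vertexDist
  push_cast
  constructor <;> intro h <;> linarith

theorem mem_wall_iff (hβ : ∀ i, β i ∈ Set.Icc (0 : ℝ) 1) (I : Finset (Fin 4)) (k : ℤ) :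
    β ∈ wall I k ↔ vertexDist I β = ((card I - k : ℤ) : ℝ) := by
  simp only [wall, Set.mem_ofPred_eq, hβ, implies_true, true_and]
  unfold vertexDist
  push_cast
  constructor <;> intro h <;> linarith

/-! ### Position of the open chambers relative to the vertices of the cube -/

theorem IsOpenChamber.subset {C : Set (Fin 4 → ℝ)} (hC : IsOpenChamber d C) :
    C ⊆ wallComplement d := by
  obtain ⟨β, -, rfl⟩ := hC
  exact connectedComponentIn_subset _ _

theorem vertexDist_ne_one (hβ : β ∈ wallComplement d) {I : Finset (Fin 4)}
    (hI : card I ≡ d + 1 [ZMOD 2]) : vertexDist I β ≠ 1 := by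
  intro h
  refine hβ.2 I (card I - 1) (Or.inl rfl) (by unfold Int.ModEq at *; omega) ?_
  rw [mem_wall_iff fun i => Set.Ioo_subset_Icc_self (hβ.1 i), h]
  simp

/-- The polytope gives the weak inequality, and equality would put `β` on a wall. -/
theorem IsInteriorChamber.one_lt {C : Set (Fin 4 → ℝ)} {𝓘 : Set (Finset (Fin 4))}
    (hC : IsInteriorChamber d 𝓘 C) (hβ : β ∈ C) {I : Finset (Fin 4)}
    (hI : card I ≡ d + 1 [ZMOD 2]) : 1 < vertexDist I β := by
  refine lt_of_le_of_ne ?_ (vertexDist_ne_one (hC.1.subset hβ) hI).symm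
  have := (hC.2.1 hβ).2 I hI
  unfold vertexDist
  push_cast at this
  linarith

theorem IsInteriorChamber.two_lt {C : Set (Fin 4 → ℝ)} {𝓘 : Set (Finset (Fin 4))}
    (hC : IsInteriorChamber d 𝓘 C) (hβ : β ∈ C) {I : Finset (Fin 4)} (hI : I ∈ 𝓘) :
    2 < vertexDist I β := by
  have := hC.2.2.2 I hI β hβ
  rw [betaSum_lt_iff] at this
  simpa using this

/-- Distances from opposite vertices add up to 4, so `I` and `Iᶜ` cannot both be farther than 2. -/
theorem IsInteriorChamber.mem_iff {C : Set (Fin 4 → ℝ)} {𝓘 : Set (Finset (Fin 4))}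
    (hC : IsInteriorChamber d 𝓘 C) (hβ : β ∈ C) {I : Finset (Fin 4)}
    (hI : card I ≡ d [ZMOD 2]) : I ∈ 𝓘 ↔ 2 < vertexDist I β := by
  refine ⟨hC.two_lt hβ, fun h => ?_⟩
  by_contra hI'
  rcases hC.2.2.1.2 I hI with h1 | h1
  · exact hI' h1.1
  · have := hC.two_lt hβ h1.1
    rw [vertexDist_compl] at this
    linarith

theorem continuous_vertexDist (I : Finset (Fin 4)) : Continuous (vertexDist I) := by
  unfold vertexDist betaSum
  fun_prop

/-- Leaving the polytope means being within 1 of some vertex `J` of parity `d + 1`. The chamber is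
connected and avoids the wall at distance 1, so this holds throughout it. Its closure contains the
boundary wall of `I'`, which identifies `J` as the vertex opposite to `I'`. -/
theorem IsExteriorChamber.three_lt {C : Set (Fin 4 → ℝ)} {I' : Finset (Fin 4)}
    (hC : IsExteriorChamber d I' C) (hβ : β ∈ C) : 3 < vertexDist I' β := by
  obtain ⟨hopen, hnot, hpar, hwall⟩ := hC
  have hsub := hopen.subset
  have hconn : IsPreconnected C := by
    obtain ⟨β₀, -, rfl⟩ := hopen
    exact isPreconnected_connectedComponentIn
  obtain ⟨γ, hγC, hγ⟩ := Set.not_subset.1 hnot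
  have hγ' : ∃ J, card J ≡ d + 1 [ZMOD 2] ∧ vertexDist J γ < 1 := by
    by_contra! h
    refine hγ ⟨fun i => Set.Ioo_subset_Icc_self ((hsub hγC).1 i), fun J hJ => ?_⟩
    have := h J hJ
    unfold vertexDist at this
    push_cast
    linarith
  obtain ⟨J, hJ, hJγ⟩ := hγ'
  have hall : ∀ α ∈ C, vertexDist J α < 1 := by
    intro α hα
    by_contra! h
    obtain ⟨α', hα', h'⟩ := hconn.intermediate_value hγC hα (continuous_vertexDist J).continuousOn
      (show (1 : ℝ) ∈ Set.Icc _ _ from ⟨hJγ.le, h⟩)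
    exact vertexDist_ne_one (hsub hα') hJ h'
  have hclosure : closure C ⊆ {α | vertexDist J α ≤ 1} :=
    closure_minimal (fun α hα => (hall α hα).le)
      (isClosed_le (continuous_vertexDist J) continuous_const)
  -- The centroid of the boundary wall. It is at distance 1 from `I'ᶜ` and farther from every other
  -- vertex, so it detects `J`.
  let α : Fin 4 → ℝ := fun i => if i ∈ I' then 1 / 4 else 3 / 4
  have hdist : ∀ K, vertexDist K α = 1 + (4 - diffCard I' K : ℝ) / 2 := by
    intro K
    have h : (4 - diffCard I' K : ℝ) = ∑ i, if i ∈ symmDiff I' K then (0 : ℝ) else 1 := by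
      have h4 : (card (symmDiff I' K) : ℝ) + card (symmDiff I' K)ᶜ = 4 := by
        exact_mod_cast card_add_card_compl _
      rw [diffCard, ← h4, add_sub_cancel_left, card]
      rw [Finset.card_eq_sum_ones, ← Finset.sum_add_sum_compl (symmDiff I' K)]
      rw [Finset.sum_eq_zero fun i hi => if_pos hi, zero_add]
      push_cast
      exact Finset.sum_congr rfl fun i hi => (if_neg (Finset.mem_compl.1 hi)).symm
    have h1 : (1 : ℝ) = ∑ i : Fin 4, 1 / 4 := by simp
    rw [h, Finset.sum_div, h1, ← Finset.sum_add_distrib, vertexDist_eq_sum]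
    refine Finset.sum_congr rfl fun i _ => ?_
    by_cases hI : i ∈ I' <;> by_cases hK : i ∈ K <;>
      simp [α, Finset.mem_symmDiff, hI, hK] <;> norm_num
  have hαwall : α ∈ wall I' (card I' - 3) := by
    rw [mem_wall_iff, hdist, diffCard_eq_zero.2 rfl]
    · norm_num
    · intro i
      by_cases hI : i ∈ I' <;> simp [α, hI] <;> norm_num
  have hle : vertexDist J α ≤ 1 := hclosure (hwall hαwall)
  rw [hdist] at hle
  have h4 : 4 ≤ diffCard I' J := by
    have : (4 : ℝ) ≤ diffCard I' J := by linarith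
    exact_mod_cast this
  have hc : I'ᶜ = J := by
    have := diffCard_compl_left I' J
    have := diffCard_nonneg I'ᶜ J
    exact diffCard_eq_zero.1 (by omega)
  have := hall β hβ
  rw [← hc, vertexDist_compl] at this
  linarith

/-- The point `vertex I` is the indicator of `Iᶜ`, and the wall is the locus at distance 3 from
`I'`; complementing turns 3 into 1. -/
theorem mem_adjacentPartitionSet_iff {I I' : Finset (Fin 4)} :
    I ∈ adjacentPartitionSet I' ↔ diffCard I I' = 1 := by
  have hv : ∀ i, vertex I i ∈ Set.Icc (0 : ℝ) 1 := by
    intro i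
    by_cases hI : i ∈ I <;> simp [vertex, hI]
  have hdist : vertexDist I' (vertex I) = diffCard Iᶜ I' := by
    have h : (diffCard Iᶜ I' : ℝ) = ∑ i, if i ∈ symmDiff Iᶜ I' then (1 : ℝ) else 0 := by
      simp [diffCard, card]
    rw [h, vertexDist_eq_sum]
    refine Finset.sum_congr rfl fun i _ => ?_
    by_cases hI : i ∈ I <;> by_cases hK : i ∈ I' <;>
      simp [vertex, Finset.mem_symmDiff, hI, hK]
  rw [adjacentPartitionSet, Set.mem_ofPred_eq, mem_wall_iff hv, hdist, Int.cast_inj,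
    diffCard_compl_left]
  omega

end Chambers

/-! ### Stability of the nilpotent strata and of the basic building blocks -/

section Main

variable {m : Fin 2 → ℤ} {z₁ : ℂ} {j j' : ℤ} {β : Fin 4 → ℝ} {𝓘 : Set (Finset (Fin 4))}
  {C : Set (Fin 4 → ℝ)} {I : Finset (Fin 4)}

theorem mem_interpLocus_incidence (L : LineSub m j) (F : QP) :
    F ∈ interpLocus m z₁ (incidence z₁ L F) j := by
  change if _ then _ else _
  split_ifs
  · exact ⟨L, rfl⟩
  · exact ⟨L, Finset.Subset.refl _⟩

theorem exists_of_mem_interpLocus {F : QP} (h : F ∈ interpLocus m z₁ I j) :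
    ∃ L : LineSub m j, I ⊆ incidence z₁ L F ∧
      (m 1 < m 0 ∧ j = m 0 → incidence z₁ L F = I) := by
  change if _ then _ else _ at h
  split_ifs at h with hc
  · obtain ⟨L, hL⟩ := h
    exact ⟨L, hL.ge, fun _ => hL⟩
  · obtain ⟨L, hL⟩ := h
    exact ⟨L, hL, fun h' => absurd h' hc⟩

theorem card_le_four (I : Finset (Fin 4)) : card I ≤ 4 := by
  have := card_add_card_compl I
  unfold card at *
  omega

/-- Over `U`, the interpolating line sub-bundle of a point of `𝒩_I` meets the flags exactly
over `I`. -/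
theorem incidence_eq_of_mem_locusU (hm : m 1 ≤ m 0) (hz₀ : z₁ ≠ 0) (hz₁ : z₁ ≠ 1) {F : QP}
    (hU : F ∈ locusU m z₁) (hj : 2 * j = deg m + 2 - card I) {L : LineSub m j}
    (hI : I ⊆ incidence z₁ L F) (hL : m 1 < m 0 ∧ j = m 0 → incidence z₁ L F = I) :
    incidence z₁ L F = I := by
  by_contra hne
  have hlt : card I < card (incidence z₁ L F) := by
    have := Finset.card_lt_card (hI.ssubset_of_ne (Ne.symm hne))
    unfold card
    omega
  have hle := card_le_four (incidence z₁ L F)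
  have hcompl := card_add_card_compl (incidence z₁ L F)
  have hdeg : deg m = m 0 + m 1 := rfl
  rcases hm.lt_or_eq with hlt' | heq
  · have hj' : j ≤ m 1 :=
      L.degree_eq_or_le.resolve_left fun h => hne (hL ⟨hlt', h⟩)
    -- The bounds force `|I| = 3` and `m 0 - m 1 = 1`. Then `L` passes through all four flags and
    -- `E₁`, which never meets `L`, through none, a pair that `U` forbids.
    obtain rfl : j = m 1 := by omega
    have hw : wedge L (firstSummand m) ≠ 0 := fun h => hlt'.ne (degree_eq_of_wedge h)
    have hinter := card_inter_incidence_le hz₀ hz₁ hw F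
    have huniv : incidence z₁ L F = Finset.univ := by
      rw [← Finset.card_eq_iff_eq_univ, Fintype.card_fin]
      unfold card at *
      omega
    have hempty : incidence z₁ (firstSummand m) F = ∅ := by
      rw [huniv, Finset.univ_inter] at hinter
      rw [← Finset.card_eq_zero]
      unfold card at *
      omega
    refine hU (incidence z₁ (firstSummand m) F) ⟨mem_interpLocus_incidence _ F, ?_⟩
    rw [hempty, Finset.compl_empty, ← huniv]
    exact mem_interpLocus_incidence L F
  · have hj0 : j = m 0 := by
      rcases L.degree_eq_or_le with h | h <;> omega
    subst hj0
    refine hU (incidence z₁ L F) ⟨mem_interpLocus_incidence L F, ?_⟩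
    change if _ then _ else _
    rw [if_neg (by omega)]
    -- Now `|I| = 2`, so `L` meets at least three flags, and a constant sub-bundle of the same
    -- degree passes through any remaining one, again contradicting `U`.
    have hone : (incidence z₁ L F)ᶜ.card ≤ 1 := by
      unfold card at *
      omega
    obtain ⟨i₀, hi₀⟩ := Finset.card_le_one_iff_subset_singleton.1 hone
    refine ⟨constantSub (Fin.forall_fin_two.2 ⟨heq.symm, rfl⟩) (F i₀).rep (F i₀).rep_nonzero,
      fun i hi => ?_⟩
    obtain rfl := Finset.mem_singleton.1 (hi₀ hi)
    have hfib : ∀ v, (constantSub (m := m) (Fin.forall_fin_two.2 ⟨heq.symm, rfl⟩) (F i).rep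
        (F i).rep_nonzero).fibre v = (F i).rep := fun v => by
      ext a
      simp [LineSub.fibre, constantSub]
    rw [mem_incidence, hfib, Projectivization.submodule_eq]
    exact Submodule.mem_span_singleton_self _

/-- If `L'` differs from `L` and has threshold `k'`, the bound on shared flags gives `2 + k' ≤
diffCard I I₂ ≤ 4`. Thresholds up to 1 are harmless in an interior chamber, and `k' = 2` forces `I₂
= Iᶜ`. -/
theorem isStable_iff_mem_of_mem_interpLocus (hm : m 1 ≤ m 0) (hz₀ : z₁ ≠ 0) (hz₁ : z₁ ≠ 1)
    (hC : IsInteriorChamber (deg m) 𝓘 C) (hβ : β ∈ C) {x : QPH m z₁} (hΦ : x.Φ = 0)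
    (hU : x.F ∈ locusU m z₁) (hj : 2 * j = deg m + 2 - card I)
    (hx : x.F ∈ interpLocus m z₁ I j) : IsStable β x ↔ I ∈ 𝓘 := by
  obtain ⟨L, hIL, hL⟩ := exists_of_mem_interpLocus hx
  have hβ' := (hC.1.subset hβ).1
  have hinv : ∀ {j' : ℤ} (L' : LineSub m j'), IsInvariant x.Φ L' := fun L' =>
    ⟨0, Submodule.zero_mem _, by rw [hΦ, Matrix.zero_mulVec, zero_smul]⟩
  have heq := incidence_eq_of_mem_locusU hm hz₀ hz₁ hU hj hIL hL
  rw [hC.mem_iff hβ (by unfold Int.ModEq; omega)]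
  constructor
  · intro h
    have := h j L (hinv L)
    rw [betaSum_lt_iff, heq, show card I - (deg m - 2 * j) = 2 by omega] at this
    exact_mod_cast this
  · intro h j' L' _
    rw [betaSum_lt_iff]
    by_cases hw : wedge L L' = 0
    · obtain rfl := degree_eq_of_wedge hw
      rw [← incidence_eq_of_wedge hw, heq, show card I - (deg m - 2 * j) = 2 by omega]
      exact_mod_cast h
    have hinter := card_inter_incidence_le hz₀ hz₁ hw x.F
    rw [heq] at hinter
    set I₂ := incidence z₁ L' x.F with hI₂
    have hn := diffCard_add_two_mul I I₂
    have hn4 := diffCard_le_four I I₂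
    have hpos := vertexDist_pos hβ' I₂
    by_cases hc0 : card I₂ - (deg m - 2 * j') ≤ 0
    · exact lt_of_le_of_lt (by exact_mod_cast hc0) hpos
    by_cases hc1 : card I₂ - (deg m - 2 * j') = 1
    · rw [hc1, Int.cast_one]
      exact hC.one_lt hβ (by unfold Int.ModEq; omega)
    exfalso
    have hcompl : Iᶜ = I₂ := by
      have := diffCard_compl_left I I₂
      exact diffCard_eq_zero.1 (by omega)
    have hcard := card_add_card_compl I
    rw [hcompl] at hcard
    have hdeg : deg m = m 0 + m 1 := rfl
    have hx' : x.F ∈ interpLocus m z₁ Iᶜ j' := hcompl ▸ mem_interpLocus_incidence L' x.F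
    have hsum : j + j' = m 0 + m 1 := by omega
    have hj' := L'.degree_eq_or_le
    -- `U` is stated for a pair of degrees `m 0`, `m 1`, so it must be settled which of `L`, `L'`
    -- has degree `m 0`.
    by_cases hj0 : j = m 0
    · obtain rfl : j' = m 1 := by omega
      subst hj0
      exact hU I ⟨hx, hx'⟩
    · have hj1 := L.degree_eq_or_le.resolve_left hj0
      obtain rfl : j' = m 0 := by omega
      obtain rfl : j = m 1 := by omega
      exact hU Iᶜ ⟨hx', by rwa [compl_compl]⟩

/-- A conditionally stable point with nonzero nilpotent Higgs field is tested by the distance from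
one vertex; there are two cases, according to the parity of `|I|`. -/
theorem isStable_iff_of_mem_nilpotentStratum (hz₀ : z₁ ≠ 0) (hz₁ : z₁ ≠ 1) {x : QPH m z₁}
    (hx : x ∈ nilpotentStratum m z₁ j I) (hs : IsCondStable x) :
    (card I ≡ deg m [ZMOD 2] ∧ ∀ β, IsStable β x ↔ 2 < vertexDist I β) ∨
      (card I ≡ deg m + 1 [ZMOD 2] ∧ ∀ β, IsStable β x ↔ 3 < vertexDist I β) := by
  obtain ⟨hΦ, -, L, hL, rfl⟩ := hx
  have hiff := fun β => (isStable_iff_of_kernel hz₀ hz₁ hΦ hL β).trans (betaSum_lt_iff _ β _)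
  have hge := card_compl_incidence_le hz₀ hz₁ hΦ hL
  have hcard := card_add_card_compl (incidence z₁ L x.F)
  obtain ⟨C, hC, β, hβ, hstab⟩ := hs
  have hlt := ((hiff β).1 hstab).trans (vertexDist_lt_four (hC.subset hβ).1 _)
  have hlt' : card (incidence z₁ L x.F) - (deg m - 2 * j) < 4 := by exact_mod_cast hlt
  -- The lower bound 2 comes from `hge`, the upper bound 3 from `hlt'`.
  obtain h | h : card (incidence z₁ L x.F) - (deg m - 2 * j) = 2 ∨
      card (incidence z₁ L x.F) - (deg m - 2 * j) = 3 := by omega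
  · rw [h] at hiff
    exact Or.inl ⟨by unfold Int.ModEq; omega, by exact_mod_cast hiff⟩
  · rw [h] at hiff
    exact Or.inr ⟨by unfold Int.ModEq; omega, by exact_mod_cast hiff⟩

theorem exists_of_isBuildingBlock {B : Set (OrbitSpace m z₁)} (hB : IsBuildingBlock m z₁ I B)
    {x : QPH m z₁} (hx : orb x ∈ B) :
    ∃ (y : QPH m z₁) (j : ℤ), orb y = orb x ∧ y ∈ nilpotentStratum m z₁ j I ∧ IsCondStable y := by
  rcases hB with rfl | ⟨j, rfl⟩
  · obtain ⟨y, ⟨hy, hs⟩, hyx⟩ := hx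
    exact ⟨y, _, hyx, hy.2, hs⟩
  · obtain ⟨y, ⟨hy, hs⟩, hyx⟩ := hx
    exact ⟨y, _, hyx, hy.2, hs⟩

theorem isStable_iff_mem_of_isInteriorChamber (hz₀ : z₁ ≠ 0) (hz₁ : z₁ ≠ 1)
    (hC : IsInteriorChamber (deg m) 𝓘 C) (hβ : β ∈ C) {x : QPH m z₁}
    (hx : x ∈ nilpotentStratum m z₁ j I) (hs : IsCondStable x) : IsStable β x ↔ I ∈ 𝓘 := by
  rcases isStable_iff_of_mem_nilpotentStratum hz₀ hz₁ hx hs with ⟨hpar, h⟩ | ⟨hpar, h⟩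
  · rw [h, hC.mem_iff hβ hpar]
  · rw [h]
    -- At threshold 3 both sides fail: `Iᶜ` is farther than 1, and `I` has the wrong parity for `𝓘`.
    refine iff_of_false ?_ fun hI => ?_
    · have hcard := card_add_card_compl I
      have := hC.one_lt hβ (I := Iᶜ) (by unfold Int.ModEq at *; omega)
      rw [vertexDist_compl] at this
      linarith
    · have := hC.2.2.1.1 I hI
      unfold Int.ModEq at *
      omega

/-- Since `β` is farther than 3 from `I'`, it is farther than 2 from the neighbours of `I'`. For a
vertex `I` differing from `I'` in `n` places, its distance is below `5 - n`. Parity makes `n` odd at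
threshold 2 and even at threshold 3. -/
theorem isStable_iff_of_isExteriorChamber (hz₀ : z₁ ≠ 0) (hz₁ : z₁ ≠ 1) {I' : Finset (Fin 4)}
    (hC : IsExteriorChamber (deg m) I' C) (hβ : β ∈ C) {x : QPH m z₁}
    (hx : x ∈ nilpotentStratum m z₁ j I) (hs : IsCondStable x) :
    IsStable β x ↔ I ∈ adjacentPartitionSet I' ∨ I = I' := by
  have h3 := hC.three_lt hβ
  have hβ' := (hC.1.subset hβ).1
  have hpar' := hC.2.2.1
  have hn := diffCard_add_two_mul I I'
  have hn0 := diffCard_nonneg I I'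
  have hn4 := diffCard_le_four I I'
  have hadd := vertexDist_le_add_diffCard hβ' I I'
  have hsub := diffCard_le_add_vertexDist hβ' Iᶜ I'ᶜ
  rw [diffCard_compl_left, diffCard_comm, diffCard_compl_left, diffCard_comm, vertexDist_compl,
    vertexDist_compl] at hsub
  push_cast at hsub
  rw [mem_adjacentPartitionSet_iff, ← diffCard_eq_zero]
  rcases isStable_iff_of_mem_nilpotentStratum hz₀ hz₁ hx hs with ⟨hpar, h⟩ | ⟨hpar, h⟩
  · rw [h]
    unfold Int.ModEq at *
    obtain hd | hd : diffCard I I' = 1 ∨ diffCard I I' = 3 := by omega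
    · rw [hd] at hadd
      refine iff_of_true ?_ (Or.inl hd)
      push_cast at hadd
      linarith
    · rw [hd] at hsub
      refine iff_of_false ?_ (by omega)
      push_cast at hsub
      linarith
  · rw [h]
    unfold Int.ModEq at *
    by_cases hd : diffCard I I' = 0
    · refine iff_of_true ?_ (Or.inr hd)
      rwa [diffCard_eq_zero.1 hd]
    · refine iff_of_false ?_ (by omega)
      have hd2 : (2 : ℝ) ≤ diffCard I I' := by
        exact_mod_cast (show (2 : ℤ) ≤ diffCard I I' by omega)
      linarith

end Main

end ParHiggs

end

theorem mainTheorem10 (m : Fin 2 → ℤ) (hm : m 1 ≤ m 0) (z₁ : ℂ) (hz₀ : z₁ ≠ 0) (hz₁ : z₁ ≠ 1) :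
    -- interior chambers: the points `𝒩_I`
    (∀ (𝓘 : Set (Finset (Fin 4))) (C : Set (Fin 4 → ℝ)),
      ParHiggs.IsInteriorChamber (ParHiggs.deg m) 𝓘 C →
      ∀ (I : Finset (Fin 4)) (x : ParHiggs.QPH m z₁), ParHiggs.orb x ∈ ParHiggs.pointN m z₁ I →
      ∀ β ∈ C, (ParHiggs.IsStable β x ↔ I ∈ 𝓘)) ∧
    -- interior chambers: the basic building blocks
    (∀ (𝓘 : Set (Finset (Fin 4))) (C : Set (Fin 4 → ℝ)),
      ParHiggs.IsInteriorChamber (ParHiggs.deg m) 𝓘 C →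
      ∀ (I : Finset (Fin 4)) (B : Set (ParHiggs.OrbitSpace m z₁)),
      ParHiggs.IsBuildingBlock m z₁ I B →
      ∀ x : ParHiggs.QPH m z₁, ParHiggs.orb x ∈ B →
      ∀ β ∈ C, (ParHiggs.IsStable β x ↔ I ∈ 𝓘)) ∧
    -- exterior chambers: the basic building blocks
    (∀ (I' : Finset (Fin 4)) (C : Set (Fin 4 → ℝ)),
      ParHiggs.IsExteriorChamber (ParHiggs.deg m) I' C →
      ∀ (I : Finset (Fin 4)) (B : Set (ParHiggs.OrbitSpace m z₁)),
      ParHiggs.IsBuildingBlock m z₁ I B →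
      ∀ x : ParHiggs.QPH m z₁, ParHiggs.orb x ∈ B →
      ∀ β ∈ C, (ParHiggs.IsStable β x ↔ (I ∈ ParHiggs.adjacentPartitionSet I' ∨ I = I'))) := by
  refine ⟨?_, ?_, ?_⟩
  · rintro 𝓘 C hC I x ⟨y, ⟨hΦ, hU, j, hj, hy⟩, hyx⟩ β hβ
    rw [← ParHiggs.isStable_iff_of_orb_eq hyx]
    exact ParHiggs.isStable_iff_mem_of_mem_interpLocus hm hz₀ hz₁ hC hβ hΦ hU hj hy
  · intro 𝓘 C hC I B hB x hx β hβ
    obtain ⟨y, j, hyx, hy, hs⟩ := ParHiggs.exists_of_isBuildingBlock hB hx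
    rw [← ParHiggs.isStable_iff_of_orb_eq hyx]
    exact ParHiggs.isStable_iff_mem_of_isInteriorChamber hz₀ hz₁ hC hβ hy hs
  · intro I' C hC I B hB x hx β hβ
    obtain ⟨y, j, hyx, hy, hs⟩ := ParHiggs.exists_of_isBuildingBlock hB hx
    rw [← ParHiggs.isStable_iff_of_orb_eq hyx]
    exact ParHiggs.isStable_iff_of_isExteriorChamber hz₀ hz₁ hC hβ hy hs
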